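/- Let $\mathcal{H}$ be a complex Hilbert space, with inner product antilinear in the first and linear in the second argument. A densely defined operator $A$ in $\mathcal{H}$ is *accretive* if $\mathrm{Re}\langle\psi,A\psi\rangle\ge 0$ for all $\psi\in\mathcal{D}(A)$, and *maximally accretive* if moreover it has no accretive operator extension other than itself. It is *sectorial* if it is accretive and there is $\varphi\in(0,2\pi)$, $\varphi\neq\pi$, such that $e^{i\varphi}A$ is accretive as well (equivalently, its numerical range is contained in a sector of the closed right half-plane with opening angle strictly less than $\pi$); it is *maximally sectorial* if it is sectorial and maximally accretive. For a sectorial operator $T$, the quadratic form $s_T(\psi)=\langle\psi,T\psi\rangle$, $\psi\in\mathcal{D}(T)$, is closable. The domain $\mathcal{Q}(T)$ of its closure consists of all $f\in\mathcal{H}$ for which there is a sequence $(f_n)$ in $\mathcal{D}(T)$ with $f_n\to f$ and $s_T(f_n-f_m)\to 0$ as $n,m\to\infty$; the value of the closure at $f$ is $\lim_n s_T(f_n)$. Let $s_{T_F}(\cdot,\cdot)$ be the sesquilinear form on $\mathcal{Q}(T)$ obtained from the closure by polarization (antilinear in the first, linear in the second argument). The *Friedrichs extension* $T_F$ of $T$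 is the operator with domain $$\mathcal{D}(T_F)=\{f\in\mathcal{Q}(T):\ \exists\, w\in\mathcal{H}\ \ \forall g\in\mathcal{Q}(T):\ s_{T_F}(g,f)=\langle g,w\rangle\},\qquad T_Ff=w.$$ A pair $(A,\widetilde A)$ of densely defined closable operators is a *dual pair* if $A\subset\widetilde A^*$ and $\widetilde A\subset A^*$; an operator $\widehat A$ with $A\subset\widehat A\subset\widetilde A^*$ is called a *proper extension* of the dual pair. **Theorem.** Let $S$ and $V\ge 0$ be symmetric operators in $\mathcal{H}$ with $\mathcal{D}(S)=\mathcal{D}(V)$, and suppose that the operators $A_\pm:=\pm iS+V$, with domain $\mathcal{D}(A_\pm)=\mathcal{D}(S)=\mathcal{D}(V)$, are sectorial. Then $(A_+,A_-)$ is a dual pair and the Friedrichs extensions $A_{\pm,F}$ of $A_\pm$ satisfy $$A_{+,F}=(A_{-,F})^*.$$ In particular, $A_{+,F}$ is a maximally sectorial operator and a proper extension of the dual pair $(A_+,A_-)$. -/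

import Mathlib

namespace SectorialOp

open Filter Topology

variable {H : Type*} [NormedAddCommGroup H] [InnerProductSpace ℂ H]

/-- An operator in `H` is accretive if it is densely defined and `Re ⟪ψ, A ψ⟫ ≥ 0` on its domain.
(The inner product is antilinear in the first argument.) -/
def IsAccretive (A : H →ₗ.[ℂ] H) : Prop :=
  Dense (A.domain : Set H) ∧ ∀ ψ : A.domain, 0 ≤ (inner ℂ (ψ : H) (A ψ)).re

/-- Accretive without any non-trivial accretive operator extension. -/
def IsMaximallyAccretive (A : H →ₗ.[ℂ] H) : Prop :=
  IsAccretive A ∧ ∀ B : H →ₗ.[ℂ] H, IsAccretive B → A ≤ B → B = A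

/-- Generalized sectoriality: `A` is accretive, and so is `e^{iφ} A` for some `φ ∈ (0, 2π)`,
`φ ≠ π`. Equivalently, the numerical range lies in a sector of the closed right half-plane whose
opening angle is strictly less than `π`. (`φ = π` would only say that the numerical range is
contained in the imaginary axis.) -/
def IsSectorial (A : H →ₗ.[ℂ] H) : Prop :=
  IsAccretive A ∧ ∃ φ : ℝ, 0 < φ ∧ φ < 2 * Real.pi ∧ φ ≠ Real.pi ∧
    IsAccretive (Complex.exp (φ * Complex.I) • A)

/-- Sectorial and maximally accretive. -/
def IsMaximallySectorial (A : H →ₗ.[ℂ] H) : Prop :=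
  IsSectorial A ∧ IsMaximallyAccretive A

/-- A dual pair: two densely defined closable operators, each contained in the adjoint of the
other. -/
def IsDualPair [CompleteSpace H] (A B : H →ₗ.[ℂ] H) : Prop :=
  Dense (A.domain : Set H) ∧ Dense (B.domain : Set H) ∧ A.IsClosable ∧ B.IsClosable ∧
    A ≤ B.adjoint ∧ B ≤ A.adjoint

/-- `E` is a proper extension of the dual pair `(A, B)`: `A ⊆ E ⊆ B^*`. -/
def IsProperExtension [CompleteSpace H] (A B E : H →ₗ.[ℂ] H) : Prop :=
  IsDualPair A B ∧ A ≤ E ∧ E ≤ B.adjoint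

/-! ### The closure of the quadratic form of an operator -/

/-- The quadratic form `s_T(ψ) = ⟪ψ, T ψ⟫`, with domain the domain of `T`. -/
noncomputable def form (T : H →ₗ.[ℂ] H) (ψ : T.domain) : ℂ := inner ℂ (ψ : H) (T ψ)

/-- The sequence `f` in the domain of `s_T` converges to `x` in `H` and `s_T(f_n - f_m) → 0`. -/
structure IsApprox (T : H →ₗ.[ℂ] H) (f : ℕ → T.domain) (x : H) : Prop where
  tendsto : Tendsto (fun n => (f n : H)) atTop (𝓝 x)
  cauchy : Tendsto (fun p : ℕ × ℕ => form T (f p.1 - f p.2)) atTop (𝓝 0)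

/-- The value at `x` of the closure of `s_T`: the common limit of `s_T(f_n)` over all sequences `f`
with `IsApprox T f x`. It is meaningful when `s_T` is closable and at least one such sequence
exists; see `tendsto_closedForm`. -/
noncomputable def closedForm (T : H →ₗ.[ℂ] H) (x : H) : ℂ :=
  Classical.epsilon fun z =>
    ∀ f : ℕ → T.domain, IsApprox T f x → Tendsto (fun n => form T (f n)) atTop (𝓝 z)

/-- The sesquilinear form obtained by polarization from the closure of `s_T`, antilinear in the
first and linear in the second argument. -/
noncomputable def closedSesq (T : H →ₗ.[ℂ] H) (x y : H) : ℂ :=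
  (closedForm T (x + y) - closedForm T (x - y) - Complex.I * closedForm T (x + Complex.I • y)
    + Complex.I * closedForm T (x - Complex.I • y)) / 4

section Helpers

variable {T : H →ₗ.[ℂ] H}

lemma exists_bound (hT : IsSectorial T) : ∃ K : ℝ, 0 < K ∧ ∀ u v : T.domain,
    ‖(inner ℂ (u : H) (T v) : ℂ)‖ ≤ K * (‖form T u‖ + ‖form T v‖) := by
  obtain ⟨hA, φ, h0, h2, hpi, hB⟩ := hT
  have hs : 0 < |Real.sin φ| := by
    rw [abs_pos]
    rcases lt_or_gt_of_ne hpi with h | h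
    · exact (Real.sin_pos_of_pos_of_lt_pi h0 h).ne'
    · have := Real.sin_pos_of_pos_of_lt_pi (x := φ - Real.pi) (by linarith) (by linarith)
      rw [Real.sin_sub_pi] at this
      linarith
  set e : ℂ := Complex.exp (φ * Complex.I) with he
  have here : e.re = Real.cos φ := Complex.exp_ofReal_mul_I_re φ
  have heim : e.im = Real.sin φ := Complex.exp_ofReal_mul_I_im φ
  set p : T.domain → ℝ := fun u => (form T u).re + (e * form T u).re with hp
  have hp1 : ∀ u, 0 ≤ (form T u).re := fun u => hA.2 u
  have hp2 : ∀ u, 0 ≤ (e * form T u).re := fun u => by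
    have := hB.2 u
    rw [LinearPMap.smul_apply, inner_smul_right] at this
    exact this
  have hpN : ∀ u, p u ≤ 2 * ‖form T u‖ := fun u => by
    have h1 := Complex.re_le_norm (form T u)
    have h2 := Complex.re_le_norm (e * form T u)
    have h3 : ‖e‖ = 1 := Complex.norm_exp_ofReal_mul_I φ
    rw [norm_mul, h3, one_mul] at h2
    simp only [hp]
    linarith
  set C : ℝ := 1 + 1 / |Real.sin φ| with hC
  have hC0 : 0 < C := by positivity
  have hNp : ∀ u, ‖form T u‖ ≤ C * p u := fun u => by
    have h1 := Complex.norm_le_abs_re_add_abs_im (form T u)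
    have h3 := hp1 u
    have h4 := hp2 u
    rw [abs_of_nonneg h3] at h1
    have h5 : |Real.sin φ| * |(form T u).im| ≤ p u := by
      have h6 : Real.sin φ * (form T u).im
          = Real.cos φ * (form T u).re - (e * form T u).re := by
        rw [Complex.mul_re, here, heim]; ring
      rw [← abs_mul, h6]
      have h7 : |Real.cos φ * (form T u).re| ≤ (form T u).re := by
        rw [abs_mul, abs_of_nonneg h3]
        exact mul_le_of_le_one_left h3 (Real.abs_cos_le_one φ)
      have h8 := abs_sub (Real.cos φ * (form T u).re) ((e * form T u).re)
      rw [abs_of_nonneg h4] at h8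
      simp only [hp]
      linarith
    have h9 : |(form T u).im| ≤ 1 / |Real.sin φ| * p u := by
      rw [one_div, ← div_eq_inv_mul, le_div_iff₀ hs]
      linarith
    have h10 : (form T u).re ≤ p u := by simp only [hp]; linarith
    rw [hC]; linarith
  have hpar : ∀ u v : T.domain, form T (u + v) + form T (u - v) = 2 * (form T u + form T v) := by
    intro u v
    simp only [form, LinearPMap.map_add, LinearPMap.map_sub, Submodule.coe_add, Submodule.coe_sub,
      inner_add_left, inner_add_right, inner_sub_left, inner_sub_right]
    ring
  have hppar : ∀ u v : T.domain, p (u + v) + p (u - v) = 2 * (p u + p v) := by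
    intro u v
    have h1 := congrArg Complex.re (hpar u v)
    have h2 := congrArg (fun z => (e * z).re) (hpar u v)
    simp only [Complex.add_re, Complex.mul_re, Complex.add_im, Complex.mul_im, Complex.re_ofNat,
      Complex.im_ofNat] at h1 h2
    simp only [hp, Complex.mul_re]
    linarith
  have hpI : ∀ v : T.domain, p (Complex.I • v) = p v := by
    intro v
    have : form T (Complex.I • v) = form T v := by
      simp only [form, LinearPMap.map_smul, Submodule.coe_smul, inner_smul_left, inner_smul_right,
        Complex.conj_I]
      rw [← mul_assoc, mul_neg, Complex.I_mul_I]; ring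
    simp only [hp, this]
  have hpol : ∀ u v : T.domain, (inner ℂ (u : H) (T v) : ℂ) =
      (form T (u + v) - form T (u - v) - Complex.I * form T (u + Complex.I • v)
        + Complex.I * form T (u - Complex.I • v)) / 4 := by
    intro u v
    simp only [form, LinearPMap.map_add, LinearPMap.map_sub, LinearPMap.map_smul,
      Submodule.coe_add, Submodule.coe_sub, Submodule.coe_smul,
      inner_add_left, inner_add_right, inner_sub_left, inner_sub_right, inner_smul_left,
      inner_smul_right, Complex.conj_I]
    ring_nf
    simp only [Complex.I_sq]
    ring
  refine ⟨2 * C, by positivity, fun u v => ?_⟩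
  have hn : ‖(inner ℂ (u : H) (T v) : ℂ)‖ ≤ (‖form T (u + v)‖ + ‖form T (u - v)‖
      + ‖form T (u + Complex.I • v)‖ + ‖form T (u - Complex.I • v)‖) / 4 := by
    rw [hpol, norm_div]
    have h4 : ‖(4 : ℂ)‖ = 4 := by norm_num
    rw [h4]
    gcongr
    refine (norm_add_le _ _).trans ?_
    gcongr
    · refine (norm_sub_le _ _).trans ?_
      gcongr
      · exact norm_sub_le _ _
      · simp
    · simp
  have h1 := hppar u v
  have h2 := hppar u (Complex.I • v)
  rw [hpI] at h2
  have k1 := hNp (u + v)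
  have k2 := hNp (u - v)
  have k3 := hNp (u + Complex.I • v)
  have k4 := hNp (u - Complex.I • v)
  have hsum : ‖(inner ℂ (u : H) (T v) : ℂ)‖ ≤ C * (p u + p v) := by
    have : C * p (u + v) + C * p (u - v) + C * p (u + Complex.I • v) + C * p (u - Complex.I • v)
        = 4 * (C * (p u + p v)) := by
      linear_combination C * h1 + C * h2
    linarith
  have := mul_le_mul_of_nonneg_left (add_le_add (hpN u) (hpN v)) hC0.le
  linarith

lemma exists_cauchySchwarz (hT : IsSectorial T) : ∃ K : ℝ, 0 < K ∧ ∀ u v : T.domain,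
    ‖(inner ℂ (u : H) (T v) : ℂ)‖ ≤ K * (√‖form T u‖ * √‖form T v‖) := by
  obtain ⟨K, hK, hb⟩ := exists_bound hT
  refine ⟨2 * K, by positivity, fun u v => ?_⟩
  set a := ‖(inner ℂ (u : H) (T v) : ℂ)‖
  have hq : ∀ t : ℝ, 0 ≤ (K * ‖form T u‖) * (t * t) + (-a) * t + K * ‖form T v‖ := by
    intro t
    rcases le_total t 0 with ht | ht
    · have h1 : 0 ≤ (-a) * t := mul_nonneg_of_nonpos_of_nonpos (by simp [a]) ht
      have h2 : 0 ≤ t * t := mul_self_nonneg t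
      positivity
    · have := hb ((t : ℂ) • u) v
      simp only [form, LinearPMap.map_smul, Submodule.coe_smul, inner_smul_left, inner_smul_right,
        norm_mul, Complex.conj_ofReal, Complex.norm_real, Real.norm_eq_abs, abs_of_nonneg ht]
        at this
      simp only [form, a]
      linarith
  have hd := discrim_le_zero hq
  rw [discrim] at hd
  rw [← Real.sqrt_mul (norm_nonneg _)]
  have h2 : 2 * K * √(‖form T u‖ * ‖form T v‖) = √((2 * K) ^ 2 * (‖form T u‖ * ‖form T v‖)) := by
    rw [Real.sqrt_mul (x := (2 * K) ^ 2) (by positivity), Real.sqrt_sq (by positivity)]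
  rw [h2]
  apply Real.le_sqrt_of_sq_le
  linarith

lemma form_smul (c : ℂ) (u : T.domain) : form T (c • u) = (starRingEnd ℂ c * c) * form T u := by
  simp only [form, LinearPMap.map_smul, Submodule.coe_smul, inner_smul_left, inner_smul_right]
  ring

lemma exists_add_bound (hT : IsSectorial T) : ∃ L : ℝ, 0 < L ∧ ∀ u v : T.domain,
    ‖form T (u + v)‖ ≤ L * (‖form T u‖ + ‖form T v‖) := by
  obtain ⟨K, hK, hb⟩ := exists_bound hT
  refine ⟨1 + 2 * K, by positivity, fun u v => ?_⟩
  have h : form T (u + v) = form T u + inner ℂ (u : H) (T v) + inner ℂ (v : H) (T u)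
      + form T v := by
    simp only [form, LinearPMap.map_add, Submodule.coe_add, inner_add_left, inner_add_right]
    ring
  rw [h]
  have h1 := norm_add₄_le (a := form T u) (b := inner ℂ (u : H) (T v)) (c := inner ℂ (v : H) (T u))
    (d := form T v)
  have h2 := hb u v
  have h3 := hb v u
  linarith

lemma IsApprox.add (hT : IsSectorial T) {f g : ℕ → T.domain} {x y : H} (hf : IsApprox T f x)
    (hg : IsApprox T g y) : IsApprox T (fun n => f n + g n) (x + y) := by
  obtain ⟨L, hL, hb⟩ := exists_add_bound hT
  refine ⟨by simpa using hf.tendsto.add hg.tendsto, ?_⟩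
  have h := (hf.cauchy.norm.add hg.cauchy.norm).const_mul L
  simp only [norm_zero, add_zero, mul_zero] at h
  refine squeeze_zero_norm (fun p => ?_) h
  rw [add_sub_add_comm]
  exact hb _ _

lemma IsApprox.smul {f : ℕ → T.domain} {x : H} (c : ℂ) (hf : IsApprox T f x) :
    IsApprox T (fun n => c • f n) (c • x) := by
  refine ⟨by simpa using hf.tendsto.const_smul c, ?_⟩
  have h := hf.cauchy.const_mul (starRingEnd ℂ c * c)
  rw [mul_zero] at h
  refine h.congr fun p => ?_
  rw [← smul_sub, form_smul]

lemma IsApprox.sub (hT : IsSectorial T) {f g : ℕ → T.domain} {x y : H} (hf : IsApprox T f x)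
    (hg : IsApprox T g y) : IsApprox T (fun n => f n - g n) (x - y) := by
  have := hf.add hT (hg.smul (-1))
  simpa [sub_eq_add_neg] using this

lemma isApprox_const (u : T.domain) : IsApprox T (fun _ => u) (u : H) :=
  ⟨tendsto_const_nhds, by simp [form]⟩

lemma IsApprox.bounded (hT : IsSectorial T) {f : ℕ → T.domain} {x : H} (hf : IsApprox T f x) :
    ∃ B : ℝ, 0 ≤ B ∧ ∀ᶠ n in atTop, √‖form T (f n)‖ ≤ B := by
  obtain ⟨L, hL, hb⟩ := exists_add_bound hT
  have h := hf.cauchy.norm.eventually (gt_mem_nhds (by simp : ‖(0 : ℂ)‖ < 1))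
  rw [eventually_atTop] at h
  obtain ⟨⟨a, b⟩, hM⟩ := h
  refine ⟨√(L * (1 + ‖form T (f b)‖)), Real.sqrt_nonneg _, ?_⟩
  filter_upwards [eventually_ge_atTop a] with n hn
  have h1 : ‖form T (f n - f b)‖ < 1 := hM (n, b) ⟨hn, le_refl b⟩
  have h2 := hb (f n - f b) (f b)
  rw [sub_add_cancel] at h2
  apply Real.sqrt_le_sqrt
  refine h2.trans ?_
  gcongr

/-- The form of a sectorial operator is closable. -/
lemma IsApprox.form_tendsto_zero (hT : IsSectorial T) {f : ℕ → T.domain} (hf : IsApprox T f 0) :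
    Tendsto (fun n => form T (f n)) atTop (𝓝 0) := by
  obtain ⟨K, hK, hb⟩ := exists_cauchySchwarz hT
  obtain ⟨B, -, hB⟩ := hf.bounded hT
  rw [Metric.tendsto_nhds]
  intro ε hε
  have hc : Tendsto (fun p : ℕ × ℕ => K * (√‖form T (f p.1 - f p.2)‖ * B)) atTop (𝓝 0) := by
    have h := ((Real.continuous_sqrt.tendsto _).comp hf.cauchy.norm).mul_const B
    have h := h.const_mul K
    simpa using h
  have h := hc.eventually (gt_mem_nhds (half_pos hε))
  rw [eventually_atTop] at h
  obtain ⟨⟨a, b⟩, hM⟩ := h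
  filter_upwards [eventually_ge_atTop a, hB] with n hn hBn
  rw [dist_zero_right]
  refine lt_of_le_of_lt ?_ (half_lt_self hε)
  have ht : Tendsto (fun m => ε / 2 + ‖(inner ℂ (f m : H) (T (f n)) : ℂ)‖) atTop
      (𝓝 (ε / 2)) := by
    have h1 : Tendsto (fun m => (inner ℂ (f m : H) (T (f n)) : ℂ)) atTop
        (𝓝 (inner ℂ (0 : H) (T (f n)))) := hf.tendsto.inner tendsto_const_nhds
    simpa using h1.norm.const_add (ε / 2)
  refine ge_of_tendsto ht ?_
  filter_upwards [eventually_ge_atTop b] with m hm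
  have h1 : form T (f n) = inner ℂ ((f n - f m : T.domain) : H) (T (f n))
      + inner ℂ (f m : H) (T (f n)) := by
    simp only [form, Submodule.coe_sub, inner_sub_left]; ring
  have h2 := hb (f n - f m) (f n)
  have h3 : K * (√‖form T (f n - f m)‖ * √‖form T (f n)‖)
      ≤ K * (√‖form T (f n - f m)‖ * B) := by gcongr
  have h4 : K * (√‖form T (f n - f m)‖ * B) < ε / 2 := hM (n, m) ⟨hn, hm⟩
  have h5 := norm_add_le (inner ℂ ((f n - f m : T.domain) : H) (T (f n)))
    (inner ℂ (f m : H) (T (f n)))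
  rw [← h1] at h5
  linarith

lemma tendsto_form_sub (hT : IsSectorial T) {ι : Type*} {l : Filter ι} {f g : ι → T.domain}
    {B : ℝ} (hfB : ∀ᶠ i in l, √‖form T (f i)‖ ≤ B)
    (hgB : ∀ᶠ i in l, √‖form T (g i)‖ ≤ B)
    (h : Tendsto (fun i => form T (f i - g i)) l (𝓝 0)) :
    Tendsto (fun i => form T (f i) - form T (g i)) l (𝓝 0) := by
  obtain ⟨K, hK, hb⟩ := exists_cauchySchwarz hT
  have hc : Tendsto (fun i => 2 * (K * (√‖form T (f i - g i)‖ * B))) l (𝓝 0) := by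
    have h := ((Real.continuous_sqrt.tendsto _).comp h.norm).mul_const B
    have h := (h.const_mul K).const_mul 2
    simpa using h
  refine squeeze_zero_norm' ?_ hc
  filter_upwards [hfB, hgB] with i hi hj
  have h1 : form T (f i) - form T (g i) = inner ℂ (f i : H) (T (f i - g i))
      + inner ℂ ((f i - g i : T.domain) : H) (T (g i)) := by
    simp only [form, Submodule.coe_sub, inner_sub_left, LinearPMap.map_sub, inner_sub_right]; ring
  rw [h1]
  refine (norm_add_le _ _).trans ?_
  have h2 := hb (f i) (f i - g i)
  have h3 := hb (f i - g i) (g i)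
  have h4 : K * (√‖form T (f i)‖ * √‖form T (f i - g i)‖)
      ≤ K * (√‖form T (f i - g i)‖ * B) := by
    rw [mul_comm (√‖form T (f i)‖)]; gcongr
  have h5 : K * (√‖form T (f i - g i)‖ * √‖form T (g i)‖)
      ≤ K * (√‖form T (f i - g i)‖ * B) := by gcongr
  linarith

/-- For a sectorial operator the closure of the form is the limit along any approximating
sequence. -/
lemma tendsto_closedForm (hT : IsSectorial T) {f : ℕ → T.domain} {x : H} (hf : IsApprox T f x) :
    Tendsto (fun n => form T (f n)) atTop (𝓝 (closedForm T x)) := by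
  have hex : ∃ z, ∀ g : ℕ → T.domain, IsApprox T g x →
      Tendsto (fun n => form T (g n)) atTop (𝓝 z) := by
    obtain ⟨B, -, hB⟩ := hf.bounded hT
    have hC : CauchySeq (fun n => form T (f n)) := by
      rw [cauchySeq_iff_tendsto_dist_atTop_0]
      have h1 : ∀ᶠ p : ℕ × ℕ in atTop, √‖form T (f p.1)‖ ≤ B := by
        rw [← prod_atTop_atTop_eq]; exact tendsto_fst.eventually hB
      have h2 : ∀ᶠ p : ℕ × ℕ in atTop, √‖form T (f p.2)‖ ≤ B := by
        rw [← prod_atTop_atTop_eq]; exact tendsto_snd.eventually hB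
      have h := (tendsto_form_sub hT (f := fun p : ℕ × ℕ => f p.1)
        (g := fun p : ℕ × ℕ => f p.2) h1 h2 hf.cauchy).norm
      simpa [dist_eq_norm] using h
    obtain ⟨z, hz⟩ := cauchySeq_tendsto_of_complete hC
    refine ⟨z, fun g hg => ?_⟩
    obtain ⟨B', -, hB'⟩ := hg.bounded hT
    have hd : IsApprox T (fun n => g n - f n) 0 := by simpa using hg.sub hT hf
    have h := tendsto_form_sub hT (f := g) (g := f) (B := max B B')
      (hB'.mono fun n h => h.trans (le_max_right B B'))
      (hB.mono fun n h => h.trans (le_max_left B B')) (hd.form_tendsto_zero hT)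
    simpa using h.add hz
  exact Classical.epsilon_spec hex f hf

lemma tendsto_closedSesq (hT : IsSectorial T) {f g : ℕ → T.domain} {x y : H}
    (hf : IsApprox T f x) (hg : IsApprox T g y) :
    Tendsto (fun n => (inner ℂ (f n : H) (T (g n)) : ℂ)) atTop (𝓝 (closedSesq T x y)) := by
  have h1 := tendsto_closedForm hT (hf.add hT hg)
  have h2 := tendsto_closedForm hT (hf.sub hT hg)
  have h3 := tendsto_closedForm hT (hf.add hT (hg.smul Complex.I))
  have h4 := tendsto_closedForm hT (hf.sub hT (hg.smul Complex.I))
  have h := (((h1.sub h2).sub (h3.const_mul Complex.I)).add (h4.const_mul Complex.I)).div_const 4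
  refine h.congr fun n => ?_
  simp only [form, LinearPMap.map_add, LinearPMap.map_sub, LinearPMap.map_smul,
    Submodule.coe_add, Submodule.coe_sub, Submodule.coe_smul,
    inner_add_left, inner_add_right, inner_sub_left, inner_sub_right, inner_smul_left,
    inner_smul_right, Complex.conj_I]
  ring_nf
  simp only [Complex.I_sq]
  ring

end Helpers

/-- The form domain `Q(T)`: the domain of the closure of the form of a sectorial operator `T`. -/
def formDomain (T : H →ₗ.[ℂ] H) (hT : IsSectorial T) : Submodule ℂ H where
  carrier := {x | ∃ f : ℕ → T.domain, IsApprox T f x}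
  zero_mem' := ⟨fun _ => 0, by simpa using isApprox_const (T := T) 0⟩
  add_mem' := by
    rintro x y ⟨f, hf⟩ ⟨g, hg⟩
    exact ⟨_, hf.add hT hg⟩
  smul_mem' := by
    rintro c x ⟨f, hf⟩
    exact ⟨_, hf.smul c⟩

lemma closedSesq_add_right {T : H →ₗ.[ℂ] H} (hT : IsSectorial T) {x y z : H}
    (hx : x ∈ formDomain T hT) (hy : y ∈ formDomain T hT) (hz : z ∈ formDomain T hT) :
    closedSesq T x (y + z) = closedSesq T x y + closedSesq T x z := by
  obtain ⟨f, hf⟩ := hx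
  obtain ⟨g, hg⟩ := hy
  obtain ⟨k, hk⟩ := hz
  refine tendsto_nhds_unique (tendsto_closedSesq hT hf (hg.add hT hk)) ?_
  refine ((tendsto_closedSesq hT hf hg).add (tendsto_closedSesq hT hf hk)).congr fun n => ?_
  rw [LinearPMap.map_add, inner_add_right]

lemma closedSesq_smul_right {T : H →ₗ.[ℂ] H} (hT : IsSectorial T) {x y : H} (c : ℂ)
    (hx : x ∈ formDomain T hT) (hy : y ∈ formDomain T hT) :
    closedSesq T x (c • y) = c * closedSesq T x y := by
  obtain ⟨f, hf⟩ := hx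
  obtain ⟨g, hg⟩ := hy
  refine tendsto_nhds_unique (tendsto_closedSesq hT hf (hg.smul c)) ?_
  refine ((tendsto_closedSesq hT hf hg).const_mul c).congr fun n => ?_
  rw [LinearPMap.map_smul, inner_smul_right]

lemma formDomain_dense {T : H →ₗ.[ℂ] H} (hT : IsSectorial T) :
    Dense (formDomain T hT : Set H) :=
  hT.1.1.mono fun x hx => ⟨_, isApprox_const ⟨x, hx⟩⟩

/-- The domain of the Friedrichs extension: those `x ∈ Q(T)` for which there is `w ∈ H` with
`s(g, x) = ⟪g, w⟫` for all `g ∈ Q(T)`, where `s` is the closure of the form of `T`. -/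
def friedrichsDomain (T : H →ₗ.[ℂ] H) (hT : IsSectorial T) : Submodule ℂ H where
  carrier := {x | x ∈ formDomain T hT ∧
    ∃ w : H, ∀ g ∈ formDomain T hT, closedSesq T g x = inner ℂ g w}
  zero_mem' := ⟨zero_mem _, 0, fun g hg => by
    simpa using closedSesq_smul_right hT 0 hg (zero_mem _)⟩
  add_mem' := by
    rintro x y ⟨hx, w, hw⟩ ⟨hy, v, hv⟩
    exact ⟨add_mem hx hy, w + v, fun g hg => by
      rw [closedSesq_add_right hT hg hx hy, hw g hg, hv g hg, inner_add_right]⟩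
  smul_mem' := by
    rintro c x ⟨hx, w, hw⟩
    exact ⟨Submodule.smul_mem _ c hx, c • w, fun g hg => by
      rw [closedSesq_smul_right hT c hg hx, hw g hg, inner_smul_right]⟩

lemma friedrichs_unique {T : H →ₗ.[ℂ] H} (hT : IsSectorial T) {w v : H}
    (h : ∀ g ∈ formDomain T hT, (inner ℂ g w : ℂ) = inner ℂ g v) : w = v :=
  (formDomain_dense hT).eq_of_inner_right ℂ h

/-- The Friedrichs extension of a sectorial operator `T`: the operator `x ↦ w` associated with the
closure of the form of `T`. -/
noncomputable def friedrichs (T : H →ₗ.[ℂ] H) (hT : IsSectorial T) : H →ₗ.[ℂ] H where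
  domain := friedrichsDomain T hT
  toFun :=
    { toFun := fun x => x.2.2.choose
      map_add' := fun x y => friedrichs_unique hT fun g hg => by
        rw [← (x + y).2.2.choose_spec g hg, inner_add_right, ← x.2.2.choose_spec g hg,
          ← y.2.2.choose_spec g hg]
        exact closedSesq_add_right hT hg x.2.1 y.2.1
      map_smul' := fun c x => friedrichs_unique hT fun g hg => by
        rw [← (c • x).2.2.choose_spec g hg, RingHom.id_apply, inner_smul_right,
          ← x.2.2.choose_spec g hg]
        exact closedSesq_smul_right hT c hg x.2.1 }

/-- The defining property of the Friedrichs extension: `s(g, x) = ⟪g, T_F x⟫`. -/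
lemma closedSesq_eq_inner_friedrichs {T : H →ₗ.[ℂ] H} (hT : IsSectorial T)
    (x : (friedrichs T hT).domain) {g : H} (hg : g ∈ formDomain T hT) :
    closedSesq T g x = inner ℂ g (friedrichs T hT x) :=
  x.2.2.choose_spec g hg

end SectorialOp

namespace SectorialOp

open Filter Topology
open scoped InnerProductSpace ComplexConjugate

open UniformSpace (Completion)

/-! Since `S` and `V` are symmetric, `A₊` and `A₋` are formal adjoints with a common domain, so
their quadratic forms are complex conjugates of each other. The closures then have the same form
domain and are conjugate there as well. This gives the inclusion of `A₊,F` in the adjoint of `A₋,F`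
(`isFormalAdjoint_friedrichs`).

Equality and maximality both follow from one range statement, `exists_friedrichs_add_self_eq`: `T_F
+ 1` is onto for every sectorial `T`. It is a Lax–Milgram argument. A sector touching the imaginary
axis prevents `Re s_T` from controlling `s_T`, but a suitable `c` with `Re c > 0` gives `|s_T| ≤ C
Re (c s_T)` (`IsSectorial.exists_rotation`). The form of `c (T + 1)` is therefore bounded and
coercive for the norm given by its own real part. -/

/-! ### Lax–Milgram for forms on a pre-Hilbert space -/

/-- Coercivity gives `‖k‖ ≤ ‖M k‖`, so the range is closed; a vector `k` orthogonal to it satisfies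
`‖k‖² ≤ Re ⟪k, M k⟫ = 0`. -/
theorem surjective_of_coercive {K : Type*} [NormedAddCommGroup K] [InnerProductSpace ℂ K]
    [CompleteSpace K] (M : K →L[ℂ] K) (hM : ∀ k, ‖k‖ ^ 2 ≤ (⟪k, M k⟫_ℂ).re) :
    Function.Surjective M := by
  have hb : ∀ k, ‖k‖ ≤ ((1 : NNReal) : ℝ) * ‖M k‖ := fun k => by
    have h1 := (Complex.re_le_norm _).trans (norm_inner_le_norm (𝕜 := ℂ) k (M k))
    have h2 := (hM k).trans h1
    rw [NNReal.coe_one, one_mul]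
    rcases (norm_nonneg k).eq_or_lt with h | h
    · rw [← h]; exact norm_nonneg _
    · rw [sq] at h2
      exact le_of_mul_le_mul_left h2 h
  have hcl : IsClosed (M.range : Set K) :=
    (M.antilipschitz_of_bound hb).isClosed_range M.uniformContinuous
  have : CompleteSpace M.range := hcl.completeSpace_coe
  have htop : M.range = ⊤ := by
    rw [← Submodule.orthogonal_eq_bot_iff, Submodule.eq_bot_iff]
    intro k hk
    have h0 : ⟪k, M k⟫_ℂ = 0 := Submodule.inner_left_of_mem_orthogonal (K := M.range) (LinearMap.mem_range_self _ k) hk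
    have := hM k
    rw [h0, Complex.zero_re] at this
    simpa using le_antisymm this (sq_nonneg _)
  exact LinearMap.range_eq_top.mp htop

/-- A weak solution of `R x = h`, for an operator `R` whose form, transported by `j`, is bounded
and coercive with respect to the seminorm of `E`. -/
theorem exists_weak_solution {H : Type*} [NormedAddCommGroup H] [InnerProductSpace ℂ H]
    [CompleteSpace H] {E : Type*} [SeminormedAddCommGroup E] [InnerProductSpace ℂ E]
    (j R : E →ₗ[ℂ] H) {C C' : ℝ} (hj : ∀ u, ‖j u‖ ≤ C' * ‖u‖)
    (hR : ∀ u v, ‖⟪j u, R v⟫_ℂ‖ ≤ C * ‖u‖ * ‖v‖)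
    (hco : ∀ u, ‖u‖ ^ 2 ≤ (⟪j u, R u⟫_ℂ).re) (h : H) :
    ∃ (f : ℕ → E) (x : H), CauchySeq f ∧ Tendsto (fun n => j (f n)) atTop (𝓝 x) ∧
      ∀ (g : ℕ → E) (y : H), CauchySeq g → Tendsto (fun n => j (g n)) atTop (𝓝 y) →
        Tendsto (fun n => ⟪j (g n), R (f n)⟫_ℂ) atTop (𝓝 ⟪y, h⟫_ℂ) := by
  let e : E →ₗ[ℂ] Completion E := (Completion.toComplL : E →L[ℂ] Completion E)
  have he : ∀ u, e u = (u : Completion E) := fun _ => rfl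
  have hen : ∀ u, ‖e u‖ = ‖u‖ := Completion.norm_coe
  have hd : DenseRange e := Completion.denseRange_coe
  have hee : ∀ u v, ⟪e u, e v⟫_ℂ = ⟪u, v⟫_ℂ := fun u v => Completion.inner_coe u v
  -- `J` need not be injective: the solution and the test vectors are reached only through sequences
  -- in `E`, so closability plays no role here.
  let J : Completion E →L[ℂ] H := j.extendOfNorm e
  have hJ : ∀ u, J (e u) = j u := LinearMap.extendOfNorm_eq hd ⟨C', fun u => by
    rw [hen]; exact hj u⟩
  let M₀ : E →ₗ[ℂ] Completion E := J.adjoint.toLinearMap ∘ₗ R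
  have hM₀ : ∀ u v, ⟪e u, M₀ v⟫_ℂ = ⟪j u, R v⟫_ℂ := fun u v => by
    rw [← hJ]; exact ContinuousLinearMap.adjoint_inner_right J (e u) (R v)
  have hM₀b : ∀ v, ‖M₀ v‖ ≤ C * ‖e v‖ := fun v => by
    have h1 : ∀ k, ‖⟪k, M₀ v⟫_ℂ‖ ≤ C * ‖k‖ * ‖v‖ := fun k => by
      refine hd.induction_on (p := fun k => ‖⟪k, M₀ v⟫_ℂ‖ ≤ C * ‖k‖ * ‖v‖) k
        (isClosed_le (by fun_prop) (by fun_prop)) fun u => ?_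
      rw [hM₀, hen]; exact hR u v
    have h2 := h1 (M₀ v)
    rw [inner_self_eq_norm_sq_to_K] at h2
    rw [hen]
    have h3 : ‖M₀ v‖ * ‖M₀ v‖ ≤ ‖M₀ v‖ * (C * ‖v‖) := by
      simp only [Complex.coe_algebraMap, norm_pow, Complex.norm_real, norm_norm] at h2
      linarith
    rcases (norm_nonneg (M₀ v)).eq_or_lt with h0 | h0
    -- The sign of `C` is not assumed; `0 ≤ C * ‖v‖` is read off from the bound on `⟪j v, R v⟫`.
    · have h4 := (norm_nonneg _).trans (hR v v)
      rcases (norm_nonneg v).eq_or_lt with h5 | h5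
      · rw [← h0, ← h5, mul_zero]
      · rw [← h0]; exact nonneg_of_mul_nonneg_left h4 h5
    · exact le_of_mul_le_mul_left h3 h0
  let M : Completion E →L[ℂ] Completion E := M₀.extendOfNorm e
  have hM : ∀ u, M (e u) = M₀ u := LinearMap.extendOfNorm_eq hd ⟨C, hM₀b⟩
  have hMco : ∀ k, ‖k‖ ^ 2 ≤ (⟪k, M k⟫_ℂ).re := fun k => by
    refine hd.induction_on (p := fun k => ‖k‖ ^ 2 ≤ (⟪k, M k⟫_ℂ).re) k
      (isClosed_le (by fun_prop) (Complex.continuous_re.comp (by fun_prop))) fun u => ?_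
    rw [hM, hM₀, hen]; exact hco u
  -- `M k = J* h` is the weak equation: pairing with `l` gives `⟪l, M k⟫ = ⟪J l, h⟫`.
  obtain ⟨k, hk⟩ := surjective_of_coercive M hMco (J.adjoint h)
  obtain ⟨f', hf', hfk⟩ := mem_closure_iff_seq_limit.mp (hd k)
  choose f hf using hf'
  obtain rfl : (fun n => e (f n)) = f' := funext hf
  have hcauchy : ∀ {g : ℕ → E}, CauchySeq g ↔ CauchySeq fun n => e (g n) :=
    fun {g} => by
    have := (Completion.isUniformInducing_coe E).cauchy_map_iff (F := map g atTop)
    rw [map_map] at this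
    exact this.symm
  refine ⟨f, J k, hcauchy.mpr hfk.cauchySeq, ?_, fun g y hg hy => ?_⟩
  · simp_rw [← hJ]
    exact (J.continuous.tendsto k).comp hfk
  · obtain ⟨l, hl⟩ := cauchySeq_tendsto_of_complete (hcauchy.mp hg)
    have hly : J l = y := by
      simp_rw [← hJ] at hy
      exact tendsto_nhds_unique ((J.continuous.tendsto l).comp hl) hy
    have h1 := hl.inner (𝕜 := ℂ) ((M.continuous.tendsto k).comp hfk)
    rw [hk, ContinuousLinearMap.adjoint_inner_right, hly] at h1
    refine h1.congr fun n => ?_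
    rw [Function.comp_apply, hM, hM₀]

/-- The sesquilinear Hermitian part of the form `(u, v) ↦ ⟪j u, R v⟫`. -/
noncomputable abbrev hermitianCore {H E : Type*} [NormedAddCommGroup H] [InnerProductSpace ℂ H]
    [AddCommGroup E] [Module ℂ E] (j R : E →ₗ[ℂ] H) (h : ∀ u, 0 ≤ (⟪j u, R u⟫_ℂ).re) :
    PreInnerProductSpace.Core ℂ E where
  inner u v := (⟪j u, R v⟫_ℂ + ⟪R u, j v⟫_ℂ) / 2
  conj_inner_symm u v := by simp [add_comm, Complex.conj_ofNat]
  re_inner_nonneg u := by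
    have h1 := h u
    have h2 : (⟪R u, j u⟫_ℂ).re = (⟪j u, R u⟫_ℂ).re := by
      rw [← inner_conj_symm, Complex.conj_re]
    change 0 ≤ ((⟪j u, R u⟫_ℂ + ⟪R u, j u⟫_ℂ) / 2).re
    rw [Complex.div_ofNat_re, Complex.add_re, h2]
    linarith
  add_left u v w := by simp only [map_add, inner_add_left]; ring
  smul_left u v c := by simp only [map_smul, inner_smul_left]; ring

/-- The form supplies its own seminorm, `‖u‖² = Re ⟪j u, R u⟫`. The lower bound by `δ` makes `j`
bounded for it, with constant `√(1 / δ)`. -/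
theorem exists_weak_solution_of_coercive {H E : Type*} [NormedAddCommGroup H]
    [InnerProductSpace ℂ H] [CompleteSpace H] [AddCommGroup E] [Module ℂ E]
    (j R : E →ₗ[ℂ] H) {δ C : ℝ} (hδ : 0 < δ)
    (hco : ∀ u, δ * ‖j u‖ ^ 2 ≤ (⟪j u, R u⟫_ℂ).re)
    (hR : ∀ u v, ‖⟪j u, R v⟫_ℂ‖ ≤ C * √(⟪j u, R u⟫_ℂ).re * √(⟪j v, R v⟫_ℂ).re) (h : H) :
    ∃ (f : ℕ → E) (x : H),
      Tendsto (fun p : ℕ × ℕ => (⟪j (f p.1 - f p.2), R (f p.1 - f p.2)⟫_ℂ).re) atTop (𝓝 0) ∧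
      Tendsto (fun n => j (f n)) atTop (𝓝 x) ∧
      ∀ (g : ℕ → E) (y : H),
        Tendsto (fun p : ℕ × ℕ => (⟪j (g p.1 - g p.2), R (g p.1 - g p.2)⟫_ℂ).re) atTop (𝓝 0) →
        Tendsto (fun n => j (g n)) atTop (𝓝 y) →
        Tendsto (fun n => ⟪j (g n), R (f n)⟫_ℂ) atTop (𝓝 ⟪y, h⟫_ℂ) := by
  have hpos : ∀ u, 0 ≤ (⟪j u, R u⟫_ℂ).re := fun u =>
    (by positivity : 0 ≤ δ * ‖j u‖ ^ 2).trans (hco u)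
  let c : PreInnerProductSpace.Core ℂ E := hermitianCore j R hpos
  let _ : SeminormedAddCommGroup E := InnerProductSpace.Core.toSeminormedAddCommGroup (𝕜 := ℂ)
  let _ : InnerProductSpace ℂ E := InnerProductSpace.ofCore c
  have hsq : ∀ u : E, ‖u‖ ^ 2 = (⟪j u, R u⟫_ℂ).re := fun u => by
    rw [InnerProductSpace.norm_sq_eq_re_inner (𝕜 := ℂ) u]
    have h2 : (⟪R u, j u⟫_ℂ).re = (⟪j u, R u⟫_ℂ).re := by
      rw [← inner_conj_symm, Complex.conj_re]
    change ((⟪j u, R u⟫_ℂ + ⟪R u, j u⟫_ℂ) / 2).re = _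
    rw [Complex.div_ofNat_re, Complex.add_re, h2]
    ring
  have hn : ∀ u : E, ‖u‖ = √(⟪j u, R u⟫_ℂ).re := fun u => by
    rw [← hsq, Real.sqrt_sq (norm_nonneg u)]
  have hc : ∀ g : ℕ → E, CauchySeq g ↔
      Tendsto (fun p : ℕ × ℕ => (⟪j (g p.1 - g p.2), R (g p.1 - g p.2)⟫_ℂ).re) atTop (𝓝 0) :=
    fun g => by
      rw [cauchySeq_iff_tendsto_dist_atTop_0]
      simp_rw [← hsq, dist_eq_norm]
      constructor
      · intro H
        simpa using H.pow 2
      · intro H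
        have := (Real.continuous_sqrt.tendsto _).comp H
        simpa [Function.comp_def] using this
  have hj : ∀ u, ‖j u‖ ≤ √(1 / δ) * ‖u‖ := fun u => by
    rw [hn, ← Real.sqrt_mul (by positivity)]
    apply Real.le_sqrt_of_sq_le
    rw [one_div, ← div_eq_inv_mul, le_div_iff₀ hδ, mul_comm]
    exact hco u
  obtain ⟨f, x, h1, h2, h3⟩ := exists_weak_solution (C := C) j R hj
    (fun u v => by rw [hn, hn]; exact hR u v) (fun u => (hsq u).le) h
  exact ⟨f, x, (hc f).mp h1, h2, fun g y hg => h3 g y ((hc g).mpr hg)⟩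

/-! ### Surjectivity of `T_F + 1` -/

variable {H : Type*} [NormedAddCommGroup H] [InnerProductSpace ℂ H] {T : H →ₗ.[ℂ] H}

/-- A complex number `c` with `Re c > 0` rotates the form of a sectorial operator into a sector
symmetric about the real axis. -/
lemma IsSectorial.exists_rotation (hT : IsSectorial T) : ∃ (c : ℂ) (C : ℝ), 0 < c.re ∧ 0 < C ∧
    ∀ u : T.domain, ‖form T u‖ ≤ C * (c * form T u).re := by
  obtain ⟨hA, φ, h0, h2, hpi, hB⟩ := hT
  have hs : Real.sin φ ≠ 0 := by
    rcases lt_or_gt_of_ne hpi with h | h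
    · exact (Real.sin_pos_of_pos_of_lt_pi h0 h).ne'
    · have := Real.sin_pos_of_pos_of_lt_pi (x := φ - Real.pi) (by linarith) (by linarith)
      rw [Real.sin_sub_pi] at this
      linarith
  have hcos : -1 < Real.cos φ := by
    have := Real.sin_sq_add_cos_sq φ
    have h3 : 0 < Real.sin φ ^ 2 := by positivity
    nlinarith
  -- With `a + ib` the value of the form, `Re (c (a + ib)) = a + q`, where `q = Re (e^{iφ} (a +
  -- ib))` and both terms are nonnegative. It dominates `a`, and `sin φ * b = cos φ * a - q` lets it
  -- dominate `|sin φ| * |b|`.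
  refine ⟨1 + Complex.exp (φ * Complex.I), 1 + 1 / |Real.sin φ|, ?_, by positivity, fun u => ?_⟩
  · rw [Complex.add_re, Complex.exp_ofReal_mul_I_re, Complex.one_re]; linarith
  have hs' : 0 < |Real.sin φ| := abs_pos.mpr hs
  have h3 : 0 ≤ (form T u).re := hA.2 u
  have h4 : 0 ≤ (Complex.exp (φ * Complex.I) * form T u).re := by
    have := hB.2 u
    rw [LinearPMap.smul_apply, inner_smul_right] at this
    exact this
  rw [Complex.mul_re, Complex.exp_ofReal_mul_I_re, Complex.exp_ofReal_mul_I_im] at h4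
  rw [add_mul 1 (Complex.exp _), one_mul, Complex.add_re, Complex.mul_re, Complex.exp_ofReal_mul_I_re,
    Complex.exp_ofReal_mul_I_im]
  have h1 := Complex.norm_le_abs_re_add_abs_im (form T u)
  rw [abs_of_nonneg h3] at h1
  set a := (form T u).re
  set b := (form T u).im
  set q := Real.cos φ * a - Real.sin φ * b with hq
  have h5 : |Real.sin φ| * |b| ≤ a + q := by
    rw [← abs_mul, show Real.sin φ * b = Real.cos φ * a - q by rw [hq]; ring]
    have h7 : |Real.cos φ * a| ≤ a := by
      rw [abs_mul, abs_of_nonneg h3]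
      exact mul_le_of_le_one_left h3 (Real.abs_cos_le_one φ)
    have h8 := abs_sub (Real.cos φ * a) q
    rw [abs_of_nonneg h4] at h8
    linarith
  have h9 : |b| ≤ 1 / |Real.sin φ| * (a + q) := by
    rw [one_div, ← div_eq_inv_mul, le_div_iff₀ hs']
    linarith
  linarith

/-- The weak solution for `c (T + 1)` with datum `c • h` lies in the form domain; cancelling `c`
gives `s(y, x) + ⟪y, x⟫ = ⟪y, h⟫`, which says that `T_F x = h - x`. -/
theorem exists_friedrichs_add_self_eq [CompleteSpace H] (hT : IsSectorial T) (h : H) :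
    ∃ x : (friedrichs T hT).domain, friedrichs T hT x + x = h := by
  obtain ⟨c, C, hc, hC, hb⟩ := hT.exists_rotation
  obtain ⟨K, hK, hcs⟩ := exists_cauchySchwarz hT
  have hc0 : c ≠ 0 := by rintro rfl; simp at hc
  let j : T.domain →ₗ[ℂ] H := T.domain.subtype
  let R : T.domain →ₗ[ℂ] H := c • (T.toFun + j)
  have hRv : ∀ u v : T.domain, ⟪j u, R v⟫_ℂ = c * (⟪(u : H), T v⟫_ℂ + ⟪(u : H), (v : H)⟫_ℂ) :=
    fun u v => by rw [← inner_add_right, ← inner_smul_right]; rfl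
  have hre : ∀ u : T.domain,
      (⟪j u, R u⟫_ℂ).re = (c * form T u).re + c.re * ‖(u : H)‖ ^ 2 := fun u => by
    rw [hRv, mul_add, inner_self_eq_norm_sq_to_K, Complex.add_re]
    congr 1
    simp [← Complex.ofReal_pow]
  have hp : ∀ u : T.domain, 0 ≤ (c * form T u).re := fun u =>
    nonneg_of_mul_nonneg_right ((norm_nonneg _).trans (hb u)) hC
  have hco : ∀ u, c.re * ‖j u‖ ^ 2 ≤ (⟪j u, R u⟫_ℂ).re := fun u => by
    rw [hre]; exact le_add_of_nonneg_left (hp u)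
  have hform : ∀ u, ‖form T u‖ ≤ C * (⟪j u, R u⟫_ℂ).re := fun u =>
    (hb u).trans (mul_le_mul_of_nonneg_left (by
      rw [hre]; have := mul_nonneg hc.le (sq_nonneg ‖(u : H)‖); linarith) hC.le)
  have hnorm : ∀ u : T.domain, ‖(u : H)‖ ≤ √(1 / c.re) * √(⟪j u, R u⟫_ℂ).re := fun u => by
    rw [← Real.sqrt_mul (by positivity)]
    apply Real.le_sqrt_of_sq_le
    rw [one_div, ← div_eq_inv_mul, le_div_iff₀ hc, mul_comm]
    exact hco u
  -- `K * C` comes from the Cauchy–Schwarz bound for `s_T` combined with `hform`, and `1 / c.re`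
  -- from `‖u‖ * ‖v‖` by `hnorm`.
  have hbound : ∀ u v, ‖⟪j u, R v⟫_ℂ‖ ≤ (‖c‖ * (K * C + 1 / c.re)) *
      √(⟪j u, R u⟫_ℂ).re * √(⟪j v, R v⟫_ℂ).re := fun u v => by
    rw [hRv, norm_mul, mul_assoc, mul_assoc]
    refine mul_le_mul_of_nonneg_left ((norm_add_le _ _).trans ?_) (norm_nonneg c)
    rw [add_mul]
    refine add_le_add ((hcs u v).trans ?_) ((norm_inner_le_norm _ _).trans ?_)
    · rw [mul_assoc]
      refine mul_le_mul_of_nonneg_left ?_ hK.le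
      have h1 := mul_le_mul (Real.sqrt_le_sqrt (hform u)) (Real.sqrt_le_sqrt (hform v))
        (Real.sqrt_nonneg _) (Real.sqrt_nonneg _)
      rw [Real.sqrt_mul hC.le, Real.sqrt_mul hC.le, mul_mul_mul_comm,
        Real.mul_self_sqrt hC.le] at h1
      exact h1
    · have h1 := mul_le_mul (hnorm u) (hnorm v) (norm_nonneg _) (by positivity)
      rwa [mul_mul_mul_comm, Real.mul_self_sqrt (by positivity)] at h1
  obtain ⟨f, x, h1, h2, h3⟩ := exists_weak_solution_of_coercive j R hc hco hbound (c • h)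
  have hf : IsApprox T f x :=
    ⟨h2, squeeze_zero_norm (fun p => hform _) (by simpa using h1.const_mul C)⟩
  have key : ∀ y ∈ formDomain T hT, closedSesq T y x = ⟪y, h - x⟫_ℂ := by
    rintro y ⟨g, hg⟩
    have hsub : Tendsto (fun p : ℕ × ℕ => ((g p.1 : H) - (g p.2 : H))) atTop (𝓝 0) := by
      rw [← prod_atTop_atTop_eq]
      simpa using (hg.tendsto.comp tendsto_fst).sub (hg.tendsto.comp tendsto_snd)
    -- A sequence approximating `y` is Cauchy for the rotated norm, since both the form and the norm
    -- of `g_n - g_m` tend to zero.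
    have h4 := h3 g y (by
      have h5 := (Complex.continuous_re.tendsto _).comp (hg.cauchy.const_mul c)
      have h6 := (hsub.norm.pow 2).const_mul c.re
      have h7 := h5.add h6
      simp only [mul_zero, Complex.zero_re, norm_zero, ne_eq, OfNat.ofNat_ne_zero,
        not_false_eq_true, zero_pow, add_zero] at h7
      refine h7.congr fun p => ?_
      rw [hre]; rfl) hg.tendsto
    have h5 := ((tendsto_closedSesq hT hg hf).add
      (hg.tendsto.inner (𝕜 := ℂ) hf.tendsto)).const_mul c
    have h6 := tendsto_nhds_unique (h5.congr fun n => (hRv (g n) (f n)).symm) h4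
    rw [inner_smul_right] at h6
    rw [inner_sub_right, ← mul_left_cancel₀ hc0 h6]
    ring
  have hx : x ∈ (friedrichs T hT).domain := ⟨⟨f, hf⟩, h - x, key⟩
  refine ⟨⟨x, hx⟩, ?_⟩
  have : friedrichs T hT ⟨x, hx⟩ = h - x := friedrichs_unique hT fun g hg => by
    rw [← closedSesq_eq_inner_friedrichs hT ⟨x, hx⟩ hg, ← key g hg]
  rw [this]; simp

/-! ### Maximal sectoriality of the Friedrichs extension -/

variable {T' : H →ₗ.[ℂ] H}

/-- For `x` in the domain of `T` the constant sequence approximates `x`, and `⟪g_n, T x⟫ → ⟪y, T x⟫`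
needs only `g_n → y` in `H`. -/
theorem le_friedrichs (hT : IsSectorial T) : T ≤ friedrichs T hT := by
  have key : ∀ x : T.domain, ∀ y ∈ formDomain T hT, closedSesq T y x = ⟪y, T x⟫_ℂ := by
    rintro x y ⟨g, hg⟩
    exact tendsto_nhds_unique (tendsto_closedSesq hT hg (isApprox_const x))
      (hg.tendsto.inner tendsto_const_nhds)
  refine ⟨fun x hx => ⟨⟨_, isApprox_const ⟨x, hx⟩⟩, T ⟨x, hx⟩, key ⟨x, hx⟩⟩, fun x y hxy => ?_⟩
  refine friedrichs_unique hT fun g hg => ?_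
  rw [← closedSesq_eq_inner_friedrichs hT y hg, ← hxy, key x g hg]

theorem dense_friedrichs_domain (hT : IsSectorial T) :
    Dense ((friedrichs T hT).domain : Set H) :=
  hT.1.1.mono (le_friedrichs hT).1

/-- The condition `Re (c s_T) ≥ 0` survives the limit defining the closed form. The cases `c = 1`
and `c = e^{iφ}` together give sectoriality. -/
theorem isAccretive_smul_friedrichs (hT : IsSectorial T) {c : ℂ} (hc : IsAccretive (c • T)) :
    IsAccretive (c • friedrichs T hT) := by
  refine ⟨dense_friedrichs_domain hT, fun x => ?_⟩
  obtain ⟨f, hf⟩ := x.2.1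
  rw [LinearPMap.smul_apply, inner_smul_right,
    ← closedSesq_eq_inner_friedrichs hT x ⟨f, hf⟩]
  refine ge_of_tendsto' ((Complex.continuous_re.tendsto _).comp
    ((tendsto_closedSesq hT hf hf).const_mul c)) fun n => ?_
  have := hc.2 (f n)
  rwa [LinearPMap.smul_apply, inner_smul_right] at this

theorem isSectorial_friedrichs (hT : IsSectorial T) : IsSectorial (friedrichs T hT) := by
  obtain ⟨φ, h0, h2, hpi, hB⟩ := hT.2
  refine ⟨?_, φ, h0, h2, hpi, isAccretive_smul_friedrichs hT hB⟩
  have h1 : IsAccretive ((1 : ℂ) • T) := by rw [one_smul]; exact hT.1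
  simpa using isAccretive_smul_friedrichs hT h1

/-- An accretive operator `A` with `A + 1` surjective is maximally accretive. -/
theorem IsAccretive.isMaximallyAccretive {A : H →ₗ.[ℂ] H} (hA : IsAccretive A)
    (hsurj : ∀ h : H, ∃ x : A.domain, A x + x = h) : IsMaximallyAccretive A := by
  refine ⟨hA, fun B hB hAB => (LinearPMap.eq_of_le_of_domain_eq hAB ?_).symm⟩
  refine le_antisymm hAB.1 fun x hx => ?_
  -- With `(A + 1) y = (B + 1) x`, the difference `z = x - y` satisfies `B z = -z`, so accretivity
  -- of `B` forces `-‖z‖² ≥ 0`.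
  obtain ⟨y, hy⟩ := hsurj (B ⟨x, hx⟩ + x)
  rw [hAB.2 (y := ⟨y, hAB.1 y.2⟩) rfl] at hy
  set z : B.domain := ⟨x, hx⟩ - ⟨y, hAB.1 y.2⟩ with hz
  have hBz : B z = -(z : H) := by
    rw [hz, LinearPMap.map_sub, Submodule.coe_sub, neg_sub, sub_eq_sub_iff_add_eq_add]
    rw [← hy]; abel
  have h1 := hB.2 z
  rw [hBz, inner_neg_right, Complex.neg_re, inner_self_eq_norm_sq_to_K] at h1
  have h2 : ‖(z : H)‖ ^ 2 ≤ 0 := by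
    simp only [Complex.coe_algebraMap, ← Complex.ofReal_pow, Complex.ofReal_re] at h1
    linarith
  have h3 : (z : H) = 0 := by simpa using le_antisymm h2 (sq_nonneg _)
  rw [hz, Submodule.coe_sub, sub_eq_zero] at h3
  change x = y at h3
  rw [h3]
  exact y.2

theorem isMaximallySectorial_friedrichs [CompleteSpace H] (hT : IsSectorial T) :
    IsMaximallySectorial (friedrichs T hT) :=
  ⟨isSectorial_friedrichs hT,
    (isSectorial_friedrichs hT).1.isMaximallyAccretive (exists_friedrichs_add_self_eq hT)⟩

/-! ### Formal adjoints with a common domain -/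

/-- On the common domain `s_{T'}` is the conjugate of `s_T`, so both forms tend to zero along the
same differences. By symmetry the two form domains coincide. -/
lemma IsApprox.of_isFormalAdjoint (hadj : T.IsFormalAdjoint T') (hdom : T.domain = T'.domain)
    {f : ℕ → T.domain} {x : H} (hf : IsApprox T f x) :
    IsApprox T' (fun n => ⟨f n, hdom ▸ (f n).2⟩) x := by
  refine ⟨hf.tendsto, ?_⟩
  have h := (Complex.continuous_conj.tendsto _).comp hf.cauchy
  rw [map_zero] at h
  refine h.congr fun p => ?_
  rw [Function.comp_apply, form, inner_conj_symm,
    hadj _ ⟨(f p.1 - f p.2 : T.domain), hdom ▸ (f p.1 - f p.2).2⟩]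
  rfl

lemma closedSesq_eq_conj (hT : IsSectorial T) (hT' : IsSectorial T')
    (hadj : T.IsFormalAdjoint T') (hdom : T.domain = T'.domain) {x y : H}
    (hx : x ∈ formDomain T hT) (hy : y ∈ formDomain T hT) :
    closedSesq T' x y = conj (closedSesq T y x) := by
  obtain ⟨f, hf⟩ := hx
  obtain ⟨g, hg⟩ := hy
  refine tendsto_nhds_unique (tendsto_closedSesq hT' (hf.of_isFormalAdjoint hadj hdom)
    (hg.of_isFormalAdjoint hadj hdom)) ?_
  refine ((Complex.continuous_conj.tendsto _).comp (tendsto_closedSesq hT hg hf)).congr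
    fun n => ?_
  rw [Function.comp_apply, inner_conj_symm]
  exact hadj (f n) ⟨g n, hdom ▸ (g n).2⟩

theorem isFormalAdjoint_friedrichs (hT : IsSectorial T) (hT' : IsSectorial T')
    (hadj : T.IsFormalAdjoint T') (hdom : T.domain = T'.domain) :
    (friedrichs T hT).IsFormalAdjoint (friedrichs T' hT') := by
  intro x y
  have hy : (y : H) ∈ formDomain T hT := by
    obtain ⟨g, hg⟩ := y.2.1
    exact ⟨_, hg.of_isFormalAdjoint hadj.symm hdom.symm⟩
  have hx : (x : H) ∈ formDomain T' hT' := by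
    obtain ⟨g, hg⟩ := x.2.1
    exact ⟨_, hg.of_isFormalAdjoint hadj hdom⟩
  rw [← inner_conj_symm, ← closedSesq_eq_inner_friedrichs hT x hy,
    ← closedSesq_eq_inner_friedrichs hT' y hx, closedSesq_eq_conj hT hT' hadj hdom x.2.1 hy]

/-- The inclusion `T_F ≤ (T'_F)*` cannot be proper: `T_F + 1` is already onto, while `(T'_F)* + 1`
is injective because `T'_F + 1` is onto. -/
theorem friedrichs_eq_adjoint [CompleteSpace H] (hT : IsSectorial T) (hT' : IsSectorial T')
    (hadj : T.IsFormalAdjoint T') (hdom : T.domain = T'.domain) :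
    friedrichs T hT = (friedrichs T' hT').adjoint := by
  have hd := dense_friedrichs_domain hT'
  have hF := isFormalAdjoint_friedrichs hT hT' hadj hdom
  have hle := hF.symm.le_adjoint hd
  refine LinearPMap.eq_of_le_of_domain_eq hle (le_antisymm hle.1 fun z hz => ?_)
  obtain ⟨x, hx⟩ := exists_friedrichs_add_self_eq hT ((friedrichs T' hT').adjoint ⟨z, hz⟩ + z)
  suffices z = x by rw [this]; exact x.2
  refine ext_inner_left ℂ fun v => ?_
  -- Every test vector is `(T'_F + 1) y`; moving `T'_F + 1` across the inner product turns the
  -- pairings with `z` and with `x` into the same number.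
  obtain ⟨y, rfl⟩ := exists_friedrichs_add_self_eq hT' v
  have h1 := (LinearPMap.adjoint_isFormalAdjoint hd).symm y ⟨z, hz⟩
  rw [inner_add_left, h1, ← inner_add_right, ← hx, inner_add_left, inner_add_right,
    hF.symm y x]

theorem isDualPair_of_isFormalAdjoint [CompleteSpace H] (hT : Dense (T.domain : Set H))
    (hT' : Dense (T'.domain : Set H)) (hadj : T.IsFormalAdjoint T') : IsDualPair T T' :=
  have h1 := hadj.symm.le_adjoint hT'
  have h2 := hadj.le_adjoint hT
  ⟨hT, hT', (LinearPMap.adjoint_isClosed hT').isClosable.leIsClosable h1,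
    (LinearPMap.adjoint_isClosed hT).isClosable.leIsClosable h2, h1, h2⟩

theorem isProperExtension_friedrichs [CompleteSpace H] (hT : IsSectorial T)
    (hT' : IsSectorial T') (hadj : T.IsFormalAdjoint T') (hdom : T.domain = T'.domain) :
    IsProperExtension T T' (friedrichs T hT) := by
  refine ⟨isDualPair_of_isFormalAdjoint hT.1.1 hT'.1.1 hadj, le_friedrichs hT, ?_⟩
  -- It suffices to restrict the pairing of `T_F` with `T'_F` to the domain of `T'`.
  refine LinearPMap.IsFormalAdjoint.le_adjoint hT'.1.1 fun x y => ?_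
  have hle := le_friedrichs hT'
  rw [hle.2 (y := ⟨x, hle.1 x.2⟩) rfl]
  exact (isFormalAdjoint_friedrichs hT hT' hadj hdom).symm _ y

lemma isFormalAdjoint_I_smul_add {S V : H →ₗ.[ℂ] H} (hS : S.IsFormalAdjoint S)
    (hV : V.IsFormalAdjoint V) :
    (Complex.I • S + V).IsFormalAdjoint ((-Complex.I) • S + V) := by
  intro x y
  rw [LinearPMap.add_apply, LinearPMap.add_apply, LinearPMap.smul_apply, LinearPMap.smul_apply,
    inner_add_left, inner_add_right, inner_smul_left, inner_smul_right, Complex.conj_I]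
  exact congrArg₂ (fun a b => -Complex.I * a + b) (hS ⟨x, x.2.1⟩ ⟨y, y.2.1⟩)
    (hV ⟨x, x.2.2⟩ ⟨y, y.2.2⟩)

end SectorialOp

theorem mainTheorem6 {H : Type*} [NormedAddCommGroup H] [InnerProductSpace ℂ H] [CompleteSpace H]
    (S V : H →ₗ.[ℂ] H)
    (hS : S.IsFormalAdjoint S) (hV : V.IsFormalAdjoint V)
    (hVpos : ∀ ψ : V.domain, 0 ≤ (inner ℂ (ψ : H) (V ψ)).re)
    (hdom : S.domain = V.domain)
    (hplus : SectorialOp.IsSectorial (Complex.I • S + V))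
    (hminus : SectorialOp.IsSectorial ((-Complex.I) • S + V)) :
    SectorialOp.friedrichs (Complex.I • S + V) hplus =
        (SectorialOp.friedrichs ((-Complex.I) • S + V) hminus).adjoint ∧
      SectorialOp.IsProperExtension (Complex.I • S + V) ((-Complex.I) • S + V)
        (SectorialOp.friedrichs (Complex.I • S + V) hplus) ∧
      SectorialOp.IsMaximallySectorial (SectorialOp.friedrichs (Complex.I • S + V) hplus) := by
  have hadj := SectorialOp.isFormalAdjoint_I_smul_add hS hV
  -- The domains agree by `rfl`: scalars leave a domain unchanged, so both are `S.domain ⊓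
  -- V.domain`.
  exact ⟨SectorialOp.friedrichs_eq_adjoint hplus hminus hadj rfl,
    SectorialOp.isProperExtension_friedrichs hplus hminus hadj rfl,
    SectorialOp.isMaximallySectorial_friedrichs hplus⟩
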